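/- For a price vector $p\in\mathbf R^K_+$ let $\mathcal B(p)=\{y\in\mathbf R^K_+: p'y=1\}$. A utility function $u:\mathbf R^K_+\to\mathbf R$ is locally nonsatiated if arbitrarily close to every bundle there is a strictly better one; a demand of $u$ at $p$ is a $y\in\mathcal B(p)$ with $u(x)\le u(y)$ for all $x\in\mathbf R^K_+$ with $p'x\le 1$. A stochastic demand system $(P_j)_j$ (one distribution on $\mathbf R^K_+$ for each price $p_j$ of a finite family) is rationalizable if there are, on some probability space, random locally nonsatiated utility functions $u_\omega$ and random vectors $y(p_j)$ such that, almost surely, $y(p_j)$ is a demand of $u_\omega$ at $p_j$ for all $j$, and $y(p_j)$ has distribution $P_j$. Let $(P_1,\dots,P_J)$ be a rationalizable stochastic demand system at prices $p_1,\dots,p_J\in\mathbf R^K_+$. Let $p_0\in\mathbf R^K_+$, $p_0\neq 0$, be a counterfactual price vector, $\mathcal B_j=\mathcal B(p_j)$, and let $z\in\mathbf R^K$ be such that $y\mapsto z'y$ is bounded on $\mathcal B_0$ (automatic if all components of $p_0$ are positive). Partition $\bigcup_{j=0}^J\mathcal B_j$ into patches: $y_1,y_2$ are in the same patch iff $\operatorname{sg}(p_j'y_1-1)=\operatorname{sg}(p_j'y_2-1)$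 for all $j=0,\dots,J$. Let $x^*_{1|j},\dots,x^*_{I^*_j|j}$ be the patches contained in $\mathcal B_j$. Let $A^*$ be the binary matrix with one row for each $x^*_{i|j}$, $0\le j\le J$, $1\le i\le I_j^*$, whose $H^*$ distinct columns are the vectors $(\mathbf 1\{y_j\in x^*_{i|j}\})_{i,j}$ of all systems of bundles $(y_0,\dots,y_J)$ for which one locally nonsatiated utility function has $y_j$ as a demand at $p_j$ for every $j=0,\dots,J$. Let $A_0^*$ consist of the rows for $j=0$ and $A_1^*$ of the rows for $j=1,\dots,J$; let $\pi_1^*=(P_j(x^*_{i|j}))_{i,\,j\ge 1}$, and let $\Delta^{H^*-1}$ be the unit simplex in $\mathbf R^{H^*}$. Put $$\underline m_{i|0}(z)=\inf\{z'y:y\in x^*_{i|0}\},\qquad \overline m_{i|0}(z)=\sup\{z'y:y\in x^*_{i|0}\},\qquad 1\le i\le I_0^*.$$ Then the minimum and the maximum below exist, and the bounds $$\min\{(\underline m_{1|0}(z),\dots,\underline m_{I_0^*|0}(z))A_0^*\nu^*: A_1^*\nu^*=\pi_1^*,\ \nu^*\in\Delta^{H^*-1}\}\le \mathbb E(z'y(p_0))\le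 \max\{(\overline m_{1|0}(z),\dots,\overline m_{I_0^*|0}(z))A_0^*\nu^*: A_1^*\nu^*=\pi_1^*,\ \nu^*\in\Delta^{H^*-1}\}$$ hold (with $z'y(p_0)$ integrable) for every distribution $P_0$ of $y(p_0)$ such that $(P_0,P_1,\dots,P_J)$ is rationalizable. They are sharp: they are the infimum and the supremum of $\mathbb E(z'y(p_0))$ over the (nonempty) set of all such $P_0$. -/

import Mathlib

open MeasureTheory Matrix

/-- The budget plane `{y ∈ ℝ^K_+ : p'y = 1}` at price vector `p`, expenditure being normalized
to one. -/
def budget {K : ℕ} (p : Fin K → ℝ) : Set (Fin K → ℝ) :=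
  {y | 0 ≤ y ∧ p ⬝ᵥ y = 1}

/-- Local nonsatiation of a utility function on `ℝ^K_+` (only the values of `u` on the nonnegative
orthant matter): arbitrarily close to every bundle there is a strictly better one. -/
def LocallyNonsatiated {K : ℕ} (u : (Fin K → ℝ) → ℝ) : Prop :=
  ∀ y, 0 ≤ y → ∀ ε > 0, ∃ y', 0 ≤ y' ∧ dist y' y < ε ∧ u y < u y'

/-- `y` is a utility maximizing demand of a consumer with utility `u` at prices `p`: it lies on the
budget plane and no affordable bundle is better. For a locally nonsatiated `u` every maximizer over
the affordable bundles lies on the budget plane. -/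
def IsDemand {K : ℕ} (p : Fin K → ℝ) (u : (Fin K → ℝ) → ℝ) (y : Fin K → ℝ) : Prop :=
  y ∈ budget p ∧ ∀ x, 0 ≤ x → p ⬝ᵥ x ≤ 1 → u x ≤ u y

/-- A stochastic demand system `P` (one distribution of demand for every price vector `p j`) is
rationalizable by a random utility model: there is a population `(Ω, μ)` of consumers `ω` with
locally nonsatiated utility functions `u ω`, whose utility maximizing demands `y j ω` at the prices
`p j` have the distributions `P j`. The heterogeneity of `u` is unrestricted; the law of `u` under
`μ` is the distribution over utility functions. -/
def Rationalizable {K : ℕ} {ι : Type} (p : ι → Fin K → ℝ) (P : ι → Measure (Fin K → ℝ)) : Prop :=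
  ∃ (Ω : Type) (_ : MeasurableSpace Ω) (μ : Measure Ω) (u : Ω → (Fin K → ℝ) → ℝ)
    (y : ι → Ω → Fin K → ℝ),
    IsProbabilityMeasure μ ∧ (∀ ω, LocallyNonsatiated (u ω)) ∧ (∀ j, Measurable (y j)) ∧
      (∀ᵐ ω ∂μ, ∀ j, IsDemand (p j) (u ω) (y j ω)) ∧ ∀ j, μ.map (y j) = P j

/-- A nonstochastic demand system (one bundle `y j` for every price vector `p j`) is rationalizable:
one locally nonsatiated utility function generates all of it. -/
def RationalizableBundles {K : ℕ} {ι : Type} (p : ι → Fin K → ℝ) (y : ι → Fin K → ℝ) : Prop :=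
  ∃ u : (Fin K → ℝ) → ℝ, LocallyNonsatiated u ∧ ∀ j, IsDemand (p j) u (y j)

/-- The bundles with sign vector `s`, i.e. with `sg (p j ' y - 1) = s j` for all `j`: where `s j` is
`0`, `1`, `-1`, they lie on, strictly above, strictly below the `j`-th budget plane. The nonempty
ones among these sets with `s j = 0` for at least one `j` are the patches. -/
def patch {K : ℕ} {ι : Type} (p : ι → Fin K → ℝ) (s : ι → SignType) : Set (Fin K → ℝ) :=
  {y | 0 ≤ y ∧ ∀ j, SignType.sign (p j ⬝ᵥ y - 1) = s j}

/-- The (labels of the) patches that the `j`-th budget consists of: the sign vectors of its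
bundles. -/
def PatchOn {K : ℕ} {ι : Type} (p : ι → Fin K → ℝ) (j : ι) : Type :=
  {s : ι → SignType // s j = 0 ∧ (patch p s).Nonempty}

noncomputable instance {K : ℕ} {ι : Type} [Finite ι] (p : ι → Fin K → ℝ) (j : ι) :
    Fintype (PatchOn p j) :=
  haveI : Finite (PatchOn p j) := Subtype.finite
  Fintype.ofFinite _

/-- The bundles in the patch with label `i`. -/
def PatchOn.set {K : ℕ} {ι : Type} {p : ι → Fin K → ℝ} {j : ι} (i : PatchOn p j) :
    Set (Fin K → ℝ) :=
  patch p i.1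

/-- The rational choice types: the ways to select one patch on every budget that occur for a
rationalizable nonstochastic demand system. They label the columns of the rational demand matrix. -/
def RationalType {K : ℕ} {ι : Type} (p : ι → Fin K → ℝ) : Type :=
  {t : ∀ j, PatchOn p j //
    ∃ y : ι → Fin K → ℝ, RationalizableBundles p y ∧ ∀ j, y j ∈ (t j).set}

noncomputable instance {K : ℕ} {ι : Type} [Finite ι] (p : ι → Fin K → ℝ) :
    Fintype (RationalType p) :=
  haveI : Finite (RationalType p) := Subtype.finite
  Fintype.ofFinite _

open Classical in
/-- The rational demand matrix: its columns are the (binary) vector representations of the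
rationalizable nonstochastic demand systems, its rows are the patches, listed budget by budget. -/
noncomputable def rationalDemandMatrix {K : ℕ} {ι : Type} (p : ι → Fin K → ℝ) :
    Matrix (Σ j, PatchOn p j) (RationalType p) ℝ :=
  fun r t => if t.1 r.1 = r.2 then 1 else 0

/-- The augmented system of prices: index `0` is the counterfactual price `p₀`, the indices `j.succ`
are the observed prices. -/
def augPrices {K J : ℕ} (p₀ : Fin K → ℝ) (p : Fin J → Fin K → ℝ) : Fin (J + 1) → Fin K → ℝ :=
  Fin.cons p₀ p

/-- The augmented stochastic demand system, with `P₀` on the counterfactual budget. -/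
noncomputable def augDemand {K J : ℕ} (P₀ : Measure (Fin K → ℝ))
    (P : Fin J → Measure (Fin K → ℝ)) : Fin (J + 1) → Measure (Fin K → ℝ) :=
  Fin.cons P₀ P

/-- The rows of the augmented rational demand matrix for the counterfactual budget. -/
noncomputable def counterfactualRows {K J : ℕ} (p₀ : Fin K → ℝ) (p : Fin J → Fin K → ℝ) :
    Matrix (PatchOn (augPrices p₀ p) 0) (RationalType (augPrices p₀ p)) ℝ :=
  (rationalDemandMatrix (augPrices p₀ p)).submatrix (fun i => ⟨0, i⟩) id

/-- The rows of the augmented rational demand matrix for the observed budgets. -/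
noncomputable def observedRows {K J : ℕ} (p₀ : Fin K → ℝ) (p : Fin J → Fin K → ℝ) :
    Matrix (Σ j : Fin J, PatchOn (augPrices p₀ p) j.succ) (RationalType (augPrices p₀ p)) ℝ :=
  (rationalDemandMatrix (augPrices p₀ p)).submatrix (fun r => ⟨r.1.succ, r.2⟩) id

/-- The observed part of the vector representation: the probabilities of the patches of the augmented system on the observed budgets. -/
noncomputable def observedProbs {K J : ℕ} (p₀ : Fin K → ℝ) (p : Fin J → Fin K → ℝ)
    (P : Fin J → Measure (Fin K → ℝ)) :
    (Σ j : Fin J, PatchOn (augPrices p₀ p) j.succ) → ℝ :=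
  fun r => (P r.1).real r.2.set

/-- The feasible set of the linear programs: the probability vectors over the columns of the
augmented rational demand matrix that reproduce the observed patch probabilities. -/
def feasible {K J : ℕ} (p₀ : Fin K → ℝ) (p : Fin J → Fin K → ℝ)
    (P : Fin J → Measure (Fin K → ℝ)) : Set (RationalType (augPrices p₀ p) → ℝ) :=
  {ν | ν ∈ stdSimplex ℝ (RationalType (augPrices p₀ p)) ∧
    observedRows p₀ p *ᵥ ν = observedProbs p₀ p P}

/-- The infimum of `z'y` over each counterfactual patch. -/
noncomputable def mLow {K J : ℕ} (p₀ : Fin K → ℝ) (p : Fin J → Fin K → ℝ) (z : Fin K → ℝ) :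
    PatchOn (augPrices p₀ p) 0 → ℝ :=
  fun i => sInf ((fun y => z ⬝ᵥ y) '' i.set)

/-- The supremum of `z'y` over each counterfactual patch. -/
noncomputable def mHigh {K J : ℕ} (p₀ : Fin K → ℝ) (p : Fin J → Fin K → ℝ) (z : Fin K → ℝ) :
    PatchOn (augPrices p₀ p) 0 → ℝ :=
  fun i => sSup ((fun y => z ⬝ᵥ y) '' i.set)

/-- The values of `𝔼 (z'y(p₀))` over all distributions `P₀` of counterfactual demand that are
jointly rationalizable with the observed demand system. -/
def consistentMeans {K J : ℕ} (p₀ : Fin K → ℝ) (p : Fin J → Fin K → ℝ)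
    (P : Fin J → Measure (Fin K → ℝ)) (z : Fin K → ℝ) : Set ℝ :=
  {e | ∃ P₀ : Measure (Fin K → ℝ), Rationalizable (augPrices p₀ p) (augDemand P₀ P) ∧
    e = ∫ y, z ⬝ᵥ y ∂P₀}

/-! Let the prices be nonnegative and the bundles lie on their budgets. A finite system is then
rationalizable exactly when some numbers `r j` respect direct revealed preference, since an
Afriat-type minimum turns them into a utility (`IsRevealedIndex.rationalizableBundles`). Only the
signs of `p j ⬝ᵥ y i - 1` matter, so bundles may move freely within their patches
(`RationalizableBundles.congr_sign`).

A random utility model therefore induces a law over rational types. This law is feasible, and the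
two objectives evaluated at it enclose the mean (`integrable_and_exists_feasible_bounds`).
Conversely, from a feasible `ν` draw a type, then draw each observed bundle from `P j` conditional
on its patch and take one fixed bundle per counterfactual patch
(`exists_rationalizable_of_feasible`). Near-extremal fixed bundles give means arbitrarily close to
the optimum. The optima exist because the feasible set is compact, and nonempty because every
rationalizable system extends to `p₀` (`RationalizableBundles.exists_cons`). -/

open Filter Topology

/-! ### Revealed preference for finite systems of bundles -/

section Bundles

variable {K : ℕ} {ι : Type} {p : ι → Fin K → ℝ} {y : ι → Fin K → ℝ}

lemma dotProduct_one_pos_of_demand {q x : Fin K → ℝ} (hq : 0 ≤ q) (hx : x ∈ budget q) :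
    0 < q ⬝ᵥ 1 := by
  have hne : q ≠ 0 := by
    rintro rfl
    simpa using hx.2
  rw [dotProduct_one]
  obtain ⟨k, hk⟩ := Function.ne_iff.mp hne
  exact Finset.sum_pos' (fun i _ => hq i) ⟨k, Finset.mem_univ _, lt_of_le_of_ne (hq k) (Ne.symm hk)⟩

/-- Some better bundle lies so close to `x` that it is still affordable. -/
lemma IsDemand.lt_of_dotProduct_lt {q : Fin K → ℝ} {u : (Fin K → ℝ) → ℝ} {x y : Fin K → ℝ}
    (hu : LocallyNonsatiated u) (hy : IsDemand q u y) (hx : 0 ≤ x) (hlt : q ⬝ᵥ x < 1) :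
    u x < u y := by
  have hc : Continuous fun w : Fin K → ℝ => q ⬝ᵥ w := by fun_prop
  have hopen : IsOpen {w : Fin K → ℝ | q ⬝ᵥ w < 1} := isOpen_lt hc continuous_const
  obtain ⟨ε, hε, hball⟩ := Metric.isOpen_iff.mp hopen x hlt
  obtain ⟨x', hx', hd, hux⟩ := hu x hx ε hε
  exact hux.trans_le (hy.2 x' hx' (le_of_lt (hball hd)))

/-- A utility index of the chosen bundles that agrees with revealed preference. -/
def IsRevealedIndex (p y : ι → Fin K → ℝ) (r : ι → ℝ) : Prop :=
  ∀ i j, (p j ⬝ᵥ y i ≤ 1 → r i ≤ r j) ∧ (p j ⬝ᵥ y i < 1 → r i < r j)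

lemma RationalizableBundles.exists_index (h : RationalizableBundles p y) :
    (∀ j, y j ∈ budget (p j)) ∧ ∃ r, IsRevealedIndex p y r := by
  obtain ⟨u, hu, hd⟩ := h
  exact ⟨fun j => (hd j).1, fun j => u (y j), fun i j =>
    ⟨(hd j).2 _ (hd i).1.1, (hd j).lt_of_dotProduct_lt hu (hd i).1.1⟩⟩

/-- Positive entries need only a steep enough `A`. Negative entries come with a strict gap in `r`,
so a small enough `B` serves them. There are finitely many conditions. -/
lemma exists_slopes [Finite ι] (a : ι → ι → ℝ) (r : ι → ℝ)
    (h : ∀ i j, (a i j ≤ 0 → r i ≤ r j) ∧ (a i j < 0 → r i < r j)) :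
    ∃ A B : ℝ, 0 < A ∧ 0 < B ∧ ∀ i j, r i ≤ r j + (A * max (a i j) 0 - B * max (-a i j) 0) := by
  have hA : ∀ᶠ A : ℝ in atTop, ∀ i j, 0 < a i j → r i - r j ≤ A * a i j := by
    refine eventually_all.mpr fun i => eventually_all.mpr fun j => ?_
    by_cases hij : 0 < a i j
    · filter_upwards [(tendsto_id.atTop_mul_const hij).eventually_ge_atTop (r i - r j)] with A hA _
      exact hA
    · exact Eventually.of_forall fun A h => absurd h hij
  have hB : ∀ᶠ B : ℝ in 𝓝[>] 0, ∀ i j, a i j < 0 → B * (-a i j) < r j - r i := by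
    refine eventually_all.mpr fun i => eventually_all.mpr fun j => ?_
    by_cases hij : a i j < 0
    · have hc : Tendsto (fun B : ℝ => B * (-a i j)) (𝓝[>] 0) (𝓝 (0 * (-a i j))) :=
        ((continuous_id.mul continuous_const).tendsto 0).mono_left nhdsWithin_le_nhds
      rw [zero_mul] at hc
      filter_upwards [hc.eventually_lt_const (sub_pos.mpr ((h i j).2 hij))] with B hB _
      exact hB
    · exact Eventually.of_forall fun A h => absurd h hij
  obtain ⟨A, hA, hA0⟩ := (hA.and (eventually_gt_atTop 0)).exists
  obtain ⟨B, hB, hB0⟩ := (hB.and self_mem_nhdsWithin).exists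
  refine ⟨A, B, hA0, hB0, fun i j => ?_⟩
  rcases lt_trichotomy (a i j) 0 with hij | hij | hij
  · rw [max_eq_right hij.le, max_eq_left (by linarith)]
    linarith [hB i j hij]
  · simpa [hij] using (h i j).1 hij.le
  · rw [max_eq_left hij.le, max_eq_right (by linarith)]
    linarith [hA i j hij]

lemma IsRevealedIndex.rationalizableBundles [Finite ι] [Nonempty ι] {r : ι → ℝ}
    (hr : IsRevealedIndex p y r) (hp : ∀ j, 0 ≤ p j) (hy : ∀ j, y j ∈ budget (p j)) :
    RationalizableBundles p y := by
  have := Fintype.ofFinite ι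
  obtain ⟨A, B, hA, hB, hAB⟩ := exists_slopes (fun i j => p j ⬝ᵥ y i - 1) r fun i j =>
    ⟨fun h => (hr i j).1 (by linarith), fun h => (hr i j).2 (by linarith)⟩
  let φ : ℝ → ℝ := fun t => A * max t 0 - B * max (-t) 0
  have hφ : StrictMono φ := by
    intro s t hst
    simp only [φ]
    rcases le_or_gt 0 s with hs | hs
    · rw [max_eq_left hs, max_eq_left (hs.trans hst.le), max_eq_right (by linarith),
        max_eq_right (by linarith)]
      nlinarith
    · have h1 : max s 0 ≤ max t 0 := max_le_max_right 0 hst.le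
      have h2 : max (-t) 0 < max (-s) 0 := by
        rw [max_eq_left (by linarith : 0 ≤ -s)]
        exact max_lt (by linarith) (by linarith)
      nlinarith
  -- On the `j`-th budget set the `j`-th term is at most `r j`. The choice of slopes keeps every
  -- term at `y i` at or above `r i`, so the minimum there is exactly `r i`.
  let u : (Fin K → ℝ) → ℝ := fun x =>
    Finset.univ.inf' Finset.univ_nonempty fun j => r j + φ (p j ⬝ᵥ x - 1)
  have hφ0 : φ 0 = 0 := by simp [φ]
  have huy : ∀ i, u (y i) = r i := by
    intro i
    refine le_antisymm ?_ (Finset.le_inf' _ _ fun j _ => hAB i j)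
    refine (Finset.inf'_le _ (Finset.mem_univ i)).trans ?_
    simp [(hy i).2, hφ0]
  refine ⟨u, ?_, fun j => ⟨hy j, fun x _ hx => ?_⟩⟩
  · intro x hx ε hε
    -- Adding to every good raises expenditure at each price vector, hence every term of the
    -- minimum.
    refine ⟨x + (ε / 2) • 1, add_nonneg hx (smul_nonneg (by positivity) zero_le_one), ?_, ?_⟩
    · refine lt_of_le_of_lt ((dist_pi_le_iff (by positivity)).mpr fun k => ?_) (half_lt_self hε)
      simp [abs_of_pos hε]
    · refine (Finset.lt_inf'_iff _).mpr fun j _ => ?_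
      refine (Finset.inf'_le _ (Finset.mem_univ j)).trans_lt ?_
      have := dotProduct_one_pos_of_demand (hp j) (hy j)
      refine add_lt_add_right (hφ ?_) _
      rw [dotProduct_add, dotProduct_smul, smul_eq_mul]
      nlinarith
  · rw [huy]
    refine (Finset.inf'_le _ (Finset.mem_univ j)).trans ?_
    have := hφ.monotone (show p j ⬝ᵥ x - 1 ≤ 0 by linarith)
    rw [hφ0] at this
    linarith

/-- Rationalizability depends on the bundles only through their patches. -/
lemma RationalizableBundles.congr_sign [Finite ι] [Nonempty ι] {y' : ι → Fin K → ℝ}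
    (h : RationalizableBundles p y) (hp : ∀ j, 0 ≤ p j) (hy' : ∀ j, 0 ≤ y' j)
    (hs : ∀ i j, SignType.sign (p j ⬝ᵥ y' i - 1) = SignType.sign (p j ⬝ᵥ y i - 1)) :
    RationalizableBundles p y' := by
  obtain ⟨hb, r, hr⟩ := h.exists_index
  have hlt : ∀ i j, p j ⬝ᵥ y' i < 1 → p j ⬝ᵥ y i < 1 := fun i j h => by
    have := hs i j
    rw [sign_neg (by linarith)] at this
    linarith [sign_eq_neg_one_iff.mp this.symm]
  have heq : ∀ i j, p j ⬝ᵥ y' i = 1 ↔ p j ⬝ᵥ y i = 1 := fun i j => by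
    rw [← sub_eq_zero, ← sign_eq_zero_iff, hs i j, sign_eq_zero_iff, sub_eq_zero]
  -- The index of the old bundles also serves the new ones.
  refine IsRevealedIndex.rationalizableBundles (r := r) (fun i j => ⟨fun h => ?_, fun h => ?_⟩) hp
    fun j => ⟨hy' j, (heq j j).mpr (hb j).2⟩
  · rcases h.lt_or_eq with h | h
    · exact (hr i j).1 (hlt i j h).le
    · exact (hr i j).1 ((heq i j).mp h).le
  · exact (hr i j).2 (hlt i j h)

lemma exists_mem_budget_add {q x : Fin K → ℝ} (hq1 : 0 < q ⬝ᵥ 1) (hx : 0 ≤ x)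
    (hqx : q ⬝ᵥ x ≤ 1) :
    ∃ δ : ℝ, 0 ≤ δ ∧ (q ⬝ᵥ x < 1 → 0 < δ) ∧ x + δ • 1 ∈ budget q := by
  have h0 : 0 ≤ (1 - q ⬝ᵥ x) / (q ⬝ᵥ 1) := div_nonneg (by linarith) hq1.le
  refine ⟨(1 - q ⬝ᵥ x) / (q ⬝ᵥ 1), h0, fun h => div_pos (by linarith) hq1,
    add_nonneg hx (smul_nonneg h0 zero_le_one), ?_⟩
  rw [dotProduct_add, dotProduct_smul, smul_eq_mul, div_mul_cancel₀ _ hq1.ne']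
  ring

lemma exists_lt_forall_lt {ι : Type} [Finite ι] (r : ι → ℝ) (R : ℝ) :
    ∃ r₀ > R, ∀ j, R < r j → r₀ < r j := by
  have : ∀ᶠ x in 𝓝[>] R, ∀ j, R < r j → x < r j := by
    refine eventually_all.mpr fun j => ?_
    by_cases h : R < r j
    · filter_upwards [nhdsWithin_le_nhds (eventually_lt_nhds h)] with x hx _ using hx
    · exact Eventually.of_forall fun _ h' => absurd h' h
  obtain ⟨x, hx, hR⟩ := (this.and self_mem_nhdsWithin).exists
  exact ⟨x, hR, hx⟩

/-- A rationalizable system of bundles extends to any further price vector. -/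
lemma RationalizableBundles.exists_cons {J : ℕ} {p : Fin J → Fin K → ℝ} {y : Fin J → Fin K → ℝ}
    (h : RationalizableBundles p y) (hp : ∀ j, 0 ≤ p j) {p₀ : Fin K → ℝ} (hp₀ : 0 ≤ p₀)
    (hne : p₀ ≠ 0) :
    ∃ y₀, RationalizableBundles (augPrices p₀ p) (Fin.cons y₀ y : Fin (J + 1) → Fin K → ℝ) := by
  obtain ⟨hb, r, hr⟩ := h.exists_index
  have hq1 : 0 < p₀ ⬝ᵥ 1 := by
    rw [dotProduct_one]
    obtain ⟨k, hk⟩ := Function.ne_iff.mp hne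
    exact Finset.sum_pos' (fun i _ => hp₀ i)
      ⟨k, Finset.mem_univ _, lt_of_le_of_ne (hp₀ k) (Ne.symm hk)⟩
  suffices H : ∃ y₀ ∈ budget p₀, ∃ r₀ : ℝ,
      (∀ j, (p j ⬝ᵥ y₀ ≤ 1 → r₀ ≤ r j) ∧ (p j ⬝ᵥ y₀ < 1 → r₀ < r j)) ∧
      ∀ i, (p₀ ⬝ᵥ y i ≤ 1 → r i ≤ r₀) ∧ (p₀ ⬝ᵥ y i < 1 → r i < r₀) by
    obtain ⟨y₀, hy₀, r₀, h1, h2⟩ := H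
    refine ⟨y₀, IsRevealedIndex.rationalizableBundles (r := Fin.cons r₀ r) ?_ ?_ ?_⟩
    · intro i j
      cases i using Fin.cases <;> cases j using Fin.cases
      · exact ⟨fun _ => le_rfl, fun h => absurd h (by simp [augPrices, hy₀.2])⟩
      · simpa [augPrices] using h1 _
      · simpa [augPrices] using h2 _
      · simpa [augPrices] using hr _ _
    · intro j
      cases j using Fin.cases
      · exact hp₀
      · exact hp _
    · intro j
      cases j using Fin.cases
      · exact hy₀
      · exact hb _
  -- The new utility level is governed by the best old bundle affordable at `p₀`.
  by_cases hex : ∃ i, p₀ ⬝ᵥ y i ≤ 1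
  · have hne' : (Finset.univ.filter fun i => p₀ ⬝ᵥ y i ≤ 1).Nonempty := by
      obtain ⟨i, hi⟩ := hex
      exact ⟨i, by simpa using hi⟩
    obtain ⟨i, hi, hmax⟩ := Finset.exists_max_image _ r hne'
    simp only [Finset.mem_filter, Finset.mem_univ, true_and] at hi hmax
    -- If a best affordable bundle `y l` is strictly inside the budget, push it out to the budget
    -- plane and place `r₀` just above `r i`. Any budget affording the new bundle has `y l` strictly
    -- inside, so its own index exceeds `r i`, hence `r₀`.
    by_cases hs : ∃ l, r l = r i ∧ p₀ ⬝ᵥ y l < 1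
    · obtain ⟨l, hl, hl1⟩ := hs
      obtain ⟨δ, -, hδ, hmem⟩ := exists_mem_budget_add hq1 (hb l).1 hl1.le
      have hδ := hδ hl1
      obtain ⟨r₀, hr₀, hr₀j⟩ := exists_lt_forall_lt r (r i)
      have key : ∀ j, p j ⬝ᵥ (y l + δ • 1) ≤ 1 → r₀ < r j := by
        intro j hj
        refine hr₀j j ?_
        rw [← hl]
        refine (hr l j).2 ?_
        have := dotProduct_one_pos_of_demand (hp j) (hb j)
        rw [dotProduct_add, dotProduct_smul, smul_eq_mul] at hj
        nlinarith
      exact ⟨_, hmem, r₀, fun j => ⟨fun h => (key j h).le, fun h => key j h.le⟩,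
        fun m => ⟨fun h => (hmax m h).trans hr₀.le, fun h => (hmax m h.le).trans_lt hr₀⟩⟩
    -- Otherwise `y i` itself, with its own index, serves as the counterfactual demand.
    · have hi1 : p₀ ⬝ᵥ y i = 1 := hi.eq_of_not_lt fun h => hs ⟨i, rfl, h⟩
      exact ⟨y i, ⟨(hb i).1, hi1⟩, r i, fun j => hr i j, fun m => ⟨hmax m, fun h =>
        lt_of_le_of_ne (hmax m h.le) fun h' => hs ⟨m, h', h⟩⟩⟩
  -- No old bundle is affordable, so any bundle on the new budget works with an index below all
  -- others.
  · push Not at hex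
    obtain ⟨δ, -, -, hmem⟩ := exists_mem_budget_add hq1 le_rfl (by simp : p₀ ⬝ᵥ 0 ≤ 1)
    obtain ⟨b, hb'⟩ := (Set.finite_range r).bddBelow
    have hlt : ∀ j, b - 1 < r j := fun j => by linarith [hb' ⟨j, rfl⟩]
    exact ⟨_, hmem, b - 1, fun j => ⟨fun _ => (hlt j).le, fun _ => hlt j⟩,
      fun i => ⟨fun h => absurd h (hex i).not_ge, fun h => absurd h (hex i).not_gt⟩⟩

lemma RationalizableBundles.exists_rationalType (h : RationalizableBundles p y) :
    ∃ t : RationalType p, ∀ j, y j ∈ (t.1 j).set := by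
  have hb := h.exists_index.1
  have hmem : ∀ j, y j ∈ patch p fun i => SignType.sign (p i ⬝ᵥ y j - 1) :=
    fun j => ⟨(hb j).1, fun _ => rfl⟩
  exact ⟨⟨fun j => ⟨fun i => SignType.sign (p i ⬝ᵥ y j - 1), by simp [(hb j).2], y j, hmem j⟩,
    y, h, hmem⟩, hmem⟩

lemma RationalType.rationalizableBundles [Finite ι] [Nonempty ι] (t : RationalType p)
    (hp : ∀ j, 0 ≤ p j) (hy : ∀ j, y j ∈ (t.1 j).set) : RationalizableBundles p y := by
  obtain ⟨y', hr, hy'⟩ := t.2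
  exact hr.congr_sign hp (fun j => (hy j).1) fun i j => ((hy i).2 j).trans ((hy' i).2 j).symm

/-! ### Patches as a measurable partition of a budget -/

lemma PatchOn.eq_of_mem {j : ι} {i i' : PatchOn p j} {x : Fin K → ℝ} (h : x ∈ i.set)
    (h' : x ∈ i'.set) : i = i' :=
  Subtype.ext (funext fun l => (h.2 l).symm.trans (h'.2 l))

lemma PatchOn.set_subset_budget {j : ι} (i : PatchOn p j) : i.set ⊆ budget (p j) := by
  intro x hx
  refine ⟨hx.1, ?_⟩
  have := hx.2 j
  rw [i.2.1, sign_eq_zero_iff] at this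
  linarith

lemma exists_patchOn_of_mem_budget {j : ι} {x : Fin K → ℝ} (hx : x ∈ budget (p j)) :
    ∃ i : PatchOn p j, x ∈ i.set :=
  ⟨⟨fun l => SignType.sign (p l ⬝ᵥ x - 1), by simp [hx.2], x, hx.1, fun _ => rfl⟩,
    hx.1, fun _ => rfl⟩

lemma measurableSet_sign_dotProduct (q : Fin K → ℝ) (s : SignType) :
    MeasurableSet {x : Fin K → ℝ | SignType.sign (q ⬝ᵥ x - 1) = s} := by
  have hc : Measurable fun x : Fin K → ℝ => q ⬝ᵥ x - 1 :=
    (by fun_prop : Continuous fun x : Fin K → ℝ => q ⬝ᵥ x - 1).measurable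
  cases s
  · simp only [SignType.zero_eq_zero, sign_eq_zero_iff]
    exact hc (measurableSet_singleton 0)
  · simp only [SignType.neg_eq_neg_one, sign_eq_neg_one_iff]
    exact hc measurableSet_Iio
  · simp only [SignType.pos_eq_one, sign_eq_one_iff]
    exact hc measurableSet_Ioi

lemma PatchOn.measurableSet [Finite ι] {j : ι} (i : PatchOn p j) : MeasurableSet i.set := by
  have : i.set = Set.Ici 0 ∩ ⋂ l, {x | SignType.sign (p l ⬝ᵥ x - 1) = i.1 l} := by
    ext x
    simp [PatchOn.set, patch]
  rw [this]
  exact measurableSet_Ici.inter (MeasurableSet.iInter fun j => measurableSet_sign_dotProduct _ _)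

lemma measurableSet_budget (q : Fin K → ℝ) : MeasurableSet (budget q) := by
  have hc : Continuous fun x : Fin K → ℝ => q ⬝ᵥ x := by fun_prop
  exact measurableSet_Ici.inter (hc.measurable (measurableSet_singleton 1))

end Bundles

/-! ### Random bundles and their types -/

section Random

variable {K : ℕ} {ι : Type} {p : ι → Fin K → ℝ}

/-- Rational types of random bundles can be selected measurably. -/
lemma exists_measurable_rationalType [Finite ι] {κ Ω : Type} [Finite κ] [MeasurableSpace Ω]
    {μ : Measure Ω} [IsProbabilityMeasure μ] (f : κ → ι) {y : κ → Ω → Fin K → ℝ}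
    (hy : ∀ j, Measurable (y j))
    (h : ∀ᵐ ω ∂μ, ∃ t : RationalType p, ∀ j, y j ω ∈ (t.1 (f j)).set) :
    ∃ T : Ω → RationalType p, (∀ t, MeasurableSet (T ⁻¹' {t})) ∧
      ∀ᵐ ω ∂μ, ∀ j, y j ω ∈ ((T ω).1 (f j)).set := by
  classical
  obtain ⟨-, t₀, -⟩ := h.exists
  let σ : Ω → κ → ι → SignType := fun ω j i => SignType.sign (p i ⬝ᵥ y j ω - 1)
  -- The type is a function of finitely many measurable signs, so an arbitrary choice is harmless.
  -- Patterns sent to `t₀` occur only on a null set.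
  let g : (κ → ι → SignType) → RationalType p := fun s =>
    if hs : ∃ t : RationalType p, ∀ j, (t.1 (f j)).1 = s j then hs.choose else t₀
  have hσ : ∀ s, MeasurableSet (σ ⁻¹' {s}) := by
    intro s
    have : σ ⁻¹' {s} = ⋂ j, ⋂ i, y j ⁻¹' {x | SignType.sign (p i ⬝ᵥ x - 1) = s j i} := by
      ext ω
      simp [σ, funext_iff]
    rw [this]
    exact MeasurableSet.iInter fun j => MeasurableSet.iInter fun i =>
      hy j (measurableSet_sign_dotProduct _ _)
  refine ⟨g ∘ σ, fun t => ?_, ?_⟩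
  · have : (g ∘ σ) ⁻¹' {t} = ⋃ s ∈ g ⁻¹' {t}, σ ⁻¹' {s} := by
      ext ω
      simp
    rw [this]
    exact MeasurableSet.biUnion (Set.to_countable _) fun s _ => hσ s
  · filter_upwards [h] with ω ⟨t, ht⟩ j
    have hs : ∃ t : RationalType p, ∀ j, (t.1 (f j)).1 = σ ω j :=
      ⟨t, fun j => funext fun i => ((ht j).2 i).symm⟩
    have hg : g (σ ω) = hs.choose := dif_pos hs
    refine ⟨(ht j).1, fun i => ?_⟩
    simp only [Function.comp, hg, hs.choose_spec j]
    rfl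

lemma sum_measureReal_preimage_mul {Ω τ : Type} [MeasurableSpace Ω] {μ : Measure Ω}
    [IsProbabilityMeasure μ] [Fintype τ] {T : Ω → τ} (hT : ∀ t, MeasurableSet (T ⁻¹' {t}))
    (g : τ → ℝ) : ∑ t, μ.real (T ⁻¹' {t}) * g t = ∫ ω, g (T ω) ∂μ := by
  let _ : MeasurableSpace τ := ⊤
  have hTm : Measurable T := measurable_to_countable' hT
  have := Measure.isProbabilityMeasure_map (μ := μ) hTm.aemeasurable
  have hg : AEStronglyMeasurable g (μ.map T) := (measurable_from_top).aestronglyMeasurable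
  rw [← integral_map hTm.aemeasurable hg, integral_fintype .of_finite]
  refine Finset.sum_congr rfl fun t _ => ?_
  rw [map_measureReal_apply hTm (hs := trivial), smul_eq_mul]

lemma Rationalizable.isProbabilityMeasure {P : ι → Measure (Fin K → ℝ)} (h : Rationalizable p P)
    (j : ι) : IsProbabilityMeasure (P j) := by
  obtain ⟨Ω, _, μ, u, y, hμ, -, hy, -, hP⟩ := h
  rw [← hP j]
  exact Measure.isProbabilityMeasure_map (hy j).aemeasurable

lemma Rationalizable.ae_mem_budget [Finite ι] {P : ι → Measure (Fin K → ℝ)}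
    (h : Rationalizable p P) (j : ι) : ∀ᵐ x ∂P j, x ∈ budget (p j) := by
  obtain ⟨Ω, _, μ, u, y, hμ, -, hy, hd, hP⟩ := h
  rw [← hP j]
  refine (ae_map_iff (p := (· ∈ budget (p j))) (hy j).aemeasurable (measurableSet_budget _)).mpr ?_
  filter_upwards [hd] with ω hω using (hω j).1

end Random

/-! ### From random utility models to feasible vectors -/

section Counterfactual

variable {K J : ℕ} {p₀ : Fin K → ℝ} {p : Fin J → Fin K → ℝ} {P : Fin J → Measure (Fin K → ℝ)}

lemma dotProduct_counterfactualRows_mulVec (m : PatchOn (augPrices p₀ p) 0 → ℝ)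
    (ν : RationalType (augPrices p₀ p) → ℝ) :
    m ⬝ᵥ (counterfactualRows p₀ p *ᵥ ν) = ∑ t, ν t * m (t.1 0) := by
  classical
  simp only [dotProduct, mulVec, counterfactualRows, rationalDemandMatrix, submatrix_apply, id,
    ite_mul, one_mul, zero_mul, Finset.mul_sum, mul_ite, mul_zero]
  rw [Finset.sum_comm]
  refine Finset.sum_congr rfl fun t _ => ?_
  rw [Finset.sum_eq_single (t.1 0)]
  · simp [mul_comm]
  · intro i _ hi
    simp [hi.symm]
  · simp

open Classical in
lemma observedRows_mulVec (ν : RationalType (augPrices p₀ p) → ℝ)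
    (r : Σ j : Fin J, PatchOn (augPrices p₀ p) j.succ) :
    (observedRows p₀ p *ᵥ ν) r = ∑ t, ν t * if t.1 r.1.succ = r.2 then 1 else 0 := by
  simp only [dotProduct, mulVec, observedRows, rationalDemandMatrix, submatrix_apply, id]
  refine Finset.sum_congr rfl fun t _ => ?_
  rw [mul_comm]

/-- Patches on a budget are disjoint, so almost surely the type selects patch `i` exactly when the
bundle lies in it. -/
lemma mem_feasible_of_types {Ω : Type} [MeasurableSpace Ω] {μ : Measure Ω}
    [IsProbabilityMeasure μ] {y : Fin J → Ω → Fin K → ℝ} (hy : ∀ j, Measurable (y j))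
    {T : Ω → RationalType (augPrices p₀ p)} (hT : ∀ t, MeasurableSet (T ⁻¹' {t}))
    (h : ∀ᵐ ω ∂μ, ∀ j, y j ω ∈ ((T ω).1 j.succ).set) (hP : ∀ j, μ.map (y j) = P j) :
    (fun t => μ.real (T ⁻¹' {t})) ∈ feasible p₀ p P := by
  classical
  refine ⟨⟨fun _ => measureReal_nonneg, ?_⟩, ?_⟩
  · simpa using sum_measureReal_preimage_mul (μ := μ) hT fun _ => 1
  · ext ⟨j, i⟩
    rw [observedRows_mulVec, sum_measureReal_preimage_mul hT
      fun t => if t.1 j.succ = i then (1 : ℝ) else 0, observedProbs]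
    simp only [← hP j]
    rw [map_measureReal_apply (hy j) i.measurableSet,
      ← integral_indicator_one (hy j i.measurableSet)]
    refine integral_congr_ae ?_
    filter_upwards [h] with ω hω
    by_cases hi : (T ω).1 j.succ = i
    · have : ω ∈ y j ⁻¹' i.set := hi ▸ hω j
      simp [hi, this]
    · have : ω ∉ y j ⁻¹' i.set := fun h' => hi (PatchOn.eq_of_mem (hω j) h')
      simp [hi, this]

/-- Extending each consumer's system to `p₀` requires only a measurable choice of the type, not of
the counterfactual bundle. -/
lemma feasible_nonempty (hp₀ : 0 ≤ p₀) (hp₀_ne : p₀ ≠ 0) (hp : ∀ j, 0 ≤ p j)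
    (hP : Rationalizable p P) : (feasible p₀ p P).Nonempty := by
  obtain ⟨Ω, _, μ, u, y, hμ, hu, hy, hd, hyP⟩ := hP
  have h : ∀ᵐ ω ∂μ, ∃ t : RationalType (augPrices p₀ p), ∀ j, y j ω ∈ (t.1 (Fin.succ j)).set := by
    filter_upwards [hd] with ω hω
    have hr : RationalizableBundles p fun j => y j ω := ⟨u ω, hu ω, hω⟩
    obtain ⟨y₀, hy₀⟩ := hr.exists_cons hp hp₀ hp₀_ne
    obtain ⟨t, ht⟩ := hy₀.exists_rationalType
    exact ⟨t, fun j => ht j.succ⟩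
  obtain ⟨T, hT, hTy⟩ := exists_measurable_rationalType Fin.succ hy h
  exact ⟨_, mem_feasible_of_types hy hT hTy hyP⟩

lemma exists_feasible_and_types {P₀ : Measure (Fin K → ℝ)}
    (h : Rationalizable (augPrices p₀ p) (augDemand P₀ P)) :
    ∃ (Ω : Type) (_ : MeasurableSpace Ω) (μ : Measure Ω) (y₀ : Ω → Fin K → ℝ)
      (i₀ : Ω → PatchOn (augPrices p₀ p) 0), ∃ ν ∈ feasible p₀ p P,
      IsProbabilityMeasure μ ∧ Measurable y₀ ∧ μ.map y₀ = P₀ ∧ (∀ᵐ ω ∂μ, y₀ ω ∈ (i₀ ω).set) ∧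
      ∀ m : PatchOn (augPrices p₀ p) 0 → ℝ, Integrable (fun ω => m (i₀ ω)) μ ∧
        m ⬝ᵥ (counterfactualRows p₀ p *ᵥ ν) = ∫ ω, m (i₀ ω) ∂μ := by
  obtain ⟨Ω, _, μ, u, y, hμ, hu, hy, hd, hyP⟩ := h
  have h : ∀ᵐ ω ∂μ, ∃ t : RationalType (augPrices p₀ p), ∀ j, y j ω ∈ (t.1 (id j)).set := by
    filter_upwards [hd] with ω hω
    exact RationalizableBundles.exists_rationalType (y := fun j => y j ω) ⟨u ω, hu ω, hω⟩
  obtain ⟨T, hT, hTy⟩ := exists_measurable_rationalType id hy h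
  refine ⟨Ω, _, μ, y 0, fun ω => (T ω).1 0, fun t => μ.real (T ⁻¹' {t}),
    mem_feasible_of_types (y := fun j => y j.succ) (fun j => hy _) hT ?_ fun j => ?_,
    hμ, hy 0, hyP 0, ?_, fun m => ⟨?_, ?_⟩⟩
  · filter_upwards [hTy] with ω hω j using hω j.succ
  · exact hyP j.succ
  · filter_upwards [hTy] with ω hω using hω 0
  · let _ : MeasurableSpace (RationalType (augPrices p₀ p)) := ⊤
    have hTm : Measurable T := measurable_to_countable' hT
    refine Integrable.of_finite (μ := μ.map T) (f := fun t : RationalType (augPrices p₀ p) =>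
      m (t.1 0)) |>.comp_measurable hTm
  · rw [dotProduct_counterfactualRows_mulVec]
    exact sum_measureReal_preimage_mul hT fun t => m (t.1 0)

/-! ### From feasible vectors to random utility models -/

lemma sum_measure_patchOn_inter {ι : Type} [Finite ι] {q : ι → Fin K → ℝ} {j : ι}
    {Q : Measure (Fin K → ℝ)} (hQ : ∀ᵐ x ∂Q, x ∈ budget (q j)) {s : Set (Fin K → ℝ)}
    (hs : MeasurableSet s) : ∑ i : PatchOn q j, Q (i.set ∩ s) = Q s := by
  have hu : ⋃ i ∈ (Finset.univ : Finset (PatchOn q j)), (i.set ∩ s) =ᵐ[Q] s := by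
    filter_upwards [hQ] with x hx
    obtain ⟨i, hi⟩ := exists_patchOn_of_mem_budget hx
    refine propext ⟨fun h => ?_, fun h => ?_⟩
    · obtain ⟨i, -, h⟩ := Set.mem_iUnion₂.mp h
      exact h.2
    · exact Set.mem_iUnion₂.mpr ⟨i, Finset.mem_univ i, hi, h⟩
  rw [← measure_congr hu, measure_biUnion_finset _ fun i _ => i.measurableSet.inter hs]
  intro i _ i' _ hne
  exact Set.disjoint_left.mpr fun x hx hx' => hne (PatchOn.eq_of_mem hx.1 hx'.1)

open Classical in
/-- The distribution `Q` conditional on the patch `i`; if `i` is null, some distribution on it. -/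
noncomputable def condPatch {ι : Type} {q : ι → Fin K → ℝ} {j : ι} (Q : Measure (Fin K → ℝ))
    (i : PatchOn q j) : Measure (Fin K → ℝ) :=
  if Q i.set = 0 then Measure.dirac i.2.2.some else ProbabilityTheory.cond Q i.set

instance {ι : Type} {q : ι → Fin K → ℝ} {j : ι} (Q : Measure (Fin K → ℝ)) [IsFiniteMeasure Q]
    (i : PatchOn q j) : IsProbabilityMeasure (condPatch Q i) := by
  unfold condPatch
  split_ifs with h
  · infer_instance
  · exact ProbabilityTheory.cond_isProbabilityMeasure h

lemma ae_mem_condPatch {ι : Type} [Finite ι] {q : ι → Fin K → ℝ} {j : ι}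
    (Q : Measure (Fin K → ℝ)) (i : PatchOn q j) : ∀ᵐ x ∂condPatch Q i, x ∈ i.set := by
  unfold condPatch
  split_ifs with h
  · exact (ae_dirac_iff i.measurableSet).mpr i.2.2.some_mem
  · exact ProbabilityTheory.ae_cond_mem i.measurableSet

lemma measure_mul_condPatch {ι : Type} [Finite ι] {q : ι → Fin K → ℝ} {j : ι}
    (Q : Measure (Fin K → ℝ)) [IsFiniteMeasure Q] (i : PatchOn q j) (s : Set (Fin K → ℝ)) :
    Q i.set * condPatch Q i s = Q (i.set ∩ s) := by
  unfold condPatch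
  split_ifs with h
  · rw [h, zero_mul, measure_inter_null_of_null_left _ h]
  · rw [mul_comm, ProbabilityTheory.cond_mul_eq_inter i.measurableSet]

/-- By feasibility the types through a patch have total weight equal to its `P j`-probability; the
rest is the law of total probability. -/
lemma sum_ofReal_mul_condPatch {ν : RationalType (augPrices p₀ p) → ℝ}
    (hν : ν ∈ feasible p₀ p P) (j : Fin J) [IsFiniteMeasure (P j)]
    (hb : ∀ᵐ x ∂P j, x ∈ budget (p j)) {s : Set (Fin K → ℝ)} (hs : MeasurableSet s) :
    ∑ t, ENNReal.ofReal (ν t) * condPatch (P j) (t.1 j.succ) s = P j s := by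
  classical
  have hcol : ∀ i : PatchOn (augPrices p₀ p) j.succ,
      ∑ t, (if t.1 j.succ = i then ENNReal.ofReal (ν t) else 0) = P j i.set := by
    intro i
    have h := congrFun hν.2 ⟨j, i⟩
    rw [observedRows_mulVec, observedProbs] at h
    have h' := congrArg ENNReal.ofReal h
    simp only [mul_ite, mul_one, mul_zero] at h'
    rw [← ofReal_measureReal (μ := P j) (s := i.set), ← h', ENNReal.ofReal_sum_of_nonneg]
    · refine Finset.sum_congr rfl fun t _ => ?_
      split_ifs <;> simp
    · intro t _
      split_ifs
      exacts [hν.1.1 t, le_rfl]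
  have hb' : ∀ᵐ x ∂P j, x ∈ budget (augPrices p₀ p j.succ) := hb
  rw [← sum_measure_patchOn_inter hb' hs]
  simp_rw [← measure_mul_condPatch, ← hcol, Finset.sum_mul]
  rw [Finset.sum_comm]
  refine Finset.sum_congr rfl fun t _ => ?_
  simp [ite_mul]

/-- Every feasible probability vector over rational types, and every choice of one bundle on each
counterfactual patch, come from a rationalizable augmented demand system. -/
lemma exists_rationalizable_of_feasible (hp₀ : 0 ≤ p₀) (hp : ∀ j, 0 ≤ p j)
    (hP : Rationalizable p P) {ν : RationalType (augPrices p₀ p) → ℝ}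
    (hν : ν ∈ feasible p₀ p P) (c : PatchOn (augPrices p₀ p) 0 → Fin K → ℝ)
    (hc : ∀ i, c i ∈ i.set) :
    ∃ P₀ : Measure (Fin K → ℝ), Rationalizable (augPrices p₀ p) (augDemand P₀ P) ∧
      ∀ z : Fin K → ℝ, ∫ y, z ⬝ᵥ y ∂P₀ =
        (fun i => z ⬝ᵥ c i) ⬝ᵥ (counterfactualRows p₀ p *ᵥ ν) := by
  classical
  have := hP.isProbabilityMeasure
  have hp' : ∀ j, 0 ≤ augPrices p₀ p j := fun j => by
    cases j using Fin.cases
    exacts [hp₀, hp _]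
  let M : RationalType (augPrices p₀ p) → Fin (J + 1) → Measure (Fin K → ℝ) := fun t =>
    Fin.cons (Measure.dirac (c (t.1 0))) fun j => condPatch (P j) (t.1 j.succ)
  have hMp : ∀ t j, IsProbabilityMeasure (M t j) := fun t j => by
    cases j using Fin.cases
    · exact inferInstanceAs (IsProbabilityMeasure (Measure.dirac (c (t.1 0))))
    · exact inferInstanceAs (IsProbabilityMeasure (condPatch _ _))
  have hMs : ∀ t j, ∀ᵐ x ∂M t j, x ∈ (t.1 j).set := fun t j => by
    cases j using Fin.cases
    · exact (ae_dirac_iff (t.1 0).measurableSet).mpr (hc _)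
    · exact ae_mem_condPatch _ _
  -- Given the type, bundles are drawn independently. Any coupling would do, since the patches alone
  -- decide rationalizability.
  let μ : Measure (Fin (J + 1) → Fin K → ℝ) := ∑ t, ENNReal.ofReal (ν t) • Measure.pi (M t)
  let P₀ : Measure (Fin K → ℝ) := ∑ t, ENNReal.ofReal (ν t) • Measure.dirac (c (t.1 0))
  have hμ : IsProbabilityMeasure μ := ⟨by
    simp only [μ, Measure.finsetSum_apply, Measure.smul_apply, measure_univ, smul_eq_mul, mul_one]
    rw [← ENNReal.ofReal_sum_of_nonneg fun t _ => hν.1.1 t, hν.1.2, ENNReal.ofReal_one]⟩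
  have hμmap : ∀ j, μ.map (fun ω => ω j) = augDemand P₀ P j := by
    intro j
    ext s hs
    have h1 : μ.map (fun ω => ω j) s = ∑ t, ENNReal.ofReal (ν t) * M t j s := by
      rw [Measure.map_apply (measurable_pi_apply j) hs]
      simp only [μ, Measure.finsetSum_apply, Measure.smul_apply, smul_eq_mul]
      refine Finset.sum_congr rfl fun t _ => ?_
      rw [← (measurePreserving_eval (M t) j).measure_preimage hs.nullMeasurableSet]
    rw [h1]
    cases j using Fin.cases
    · simp [augDemand, P₀, M, Measure.finsetSum_apply]
    · exact sum_ofReal_mul_condPatch hν _ (hP.ae_mem_budget _) hs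
  have hμr : ∀ᵐ ω ∂μ, RationalizableBundles (augPrices p₀ p) ω := by
    simp only [μ, ae_finsetSum_measure_iff]
    intro t _
    refine Measure.ae_smul_measure ?_ _
    have : ∀ᵐ ω ∂Measure.pi (M t), ∀ j, ω j ∈ (t.1 j).set :=
      ae_all_iff.mpr fun j =>
        (measurePreserving_eval (M t) j).quasiMeasurePreserving.ae (hMs t j)
    filter_upwards [this] with ω hω using t.rationalizableBundles hp' hω
  obtain ⟨ω₀, u₀, hu₀, -⟩ := hμr.exists
  -- No measurability in `ω` is required, so utilities are chosen pointwise; `u₀` keeps local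
  -- nonsatiation on the exceptional null set.
  let u : (Fin (J + 1) → Fin K → ℝ) → (Fin K → ℝ) → ℝ := fun ω =>
    if h : RationalizableBundles (augPrices p₀ p) ω then h.choose else u₀
  refine ⟨P₀, ⟨_, _, μ, u, fun j ω => ω j, hμ, fun ω => ?_, measurable_pi_apply, ?_, hμmap⟩, ?_⟩
  · by_cases h : RationalizableBundles (augPrices p₀ p) ω
    · simpa [u, h] using h.choose_spec.1
    · simpa [u, h] using hu₀
  · filter_upwards [hμr] with ω h
    simpa [u, h] using h.choose_spec.2
  · intro z
    rw [dotProduct_counterfactualRows_mulVec, integral_finsetSum_measure]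
    · refine Finset.sum_congr rfl fun t _ => ?_
      rw [integral_smul_measure, integral_dirac, ENNReal.toReal_ofReal (hν.1.1 t), smul_eq_mul]
    · intro t _
      exact (integrable_dirac (by simp)).smul_measure ENNReal.ofReal_ne_top

lemma isCompact_feasible : IsCompact (feasible p₀ p P) := by
  refine (isCompact_stdSimplex _ _).inter_right (isClosed_singleton.preimage ?_)
  exact Continuous.matrix_mulVec continuous_const continuous_id

/-- The bounds for `𝔼 (z'y(p₀))` from below and from above by values of linear programs. -/
lemma integrable_and_exists_feasible_bounds {P₀ : Measure (Fin K → ℝ)}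
    (h : Rationalizable (augPrices p₀ p) (augDemand P₀ P)) {z : Fin K → ℝ}
    (hz : Bornology.IsBounded ((fun y => z ⬝ᵥ y) '' budget p₀)) :
    Integrable (fun y => z ⬝ᵥ y) P₀ ∧ ∃ ν ∈ feasible p₀ p P,
      mLow p₀ p z ⬝ᵥ (counterfactualRows p₀ p *ᵥ ν) ≤ ∫ y, z ⬝ᵥ y ∂P₀ ∧
      ∫ y, z ⬝ᵥ y ∂P₀ ≤ mHigh p₀ p z ⬝ᵥ (counterfactualRows p₀ p *ᵥ ν) := by
  obtain ⟨Ω, _, μ, y₀, i₀, ν, hν, hμ, hy₀, hP₀, hmem, hm⟩ := exists_feasible_and_types h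
  have hsub : ∀ i : PatchOn (augPrices p₀ p) 0, i.set ⊆ budget p₀ := fun i => i.set_subset_budget
  have hc : Continuous fun y : Fin K → ℝ => z ⬝ᵥ y := by fun_prop
  obtain ⟨C, hC⟩ := hz.exists_norm_le
  have hint : Integrable (fun ω => z ⬝ᵥ y₀ ω) μ := by
    refine Integrable.of_bound (hc.measurable.comp hy₀).aestronglyMeasurable C ?_
    filter_upwards [hmem] with ω hω using hC _ ⟨_, hsub _ hω, rfl⟩
  rw [← hP₀, integral_map hy₀.aemeasurable hc.aestronglyMeasurable]
  refine ⟨(integrable_map_measure hc.aestronglyMeasurable hy₀.aemeasurable).mpr hint, ν, hν, ?_, ?_⟩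
  · rw [(hm _).2]
    refine integral_mono_ae (hm _).1 hint ?_
    filter_upwards [hmem] with ω hω
    exact csInf_le (hz.bddBelow.mono (Set.image_mono (hsub _))) ⟨_, hω, rfl⟩
  · rw [(hm _).2]
    refine integral_mono_ae hint (hm _).1 ?_
    filter_upwards [hmem] with ω hω
    exact le_csSup (hz.bddAbove.mono (Set.image_mono (hsub _))) ⟨_, hω, rfl⟩

lemma dotProduct_counterfactualRows_le {ν : RationalType (augPrices p₀ p) → ℝ}
    (hν : ν ∈ feasible p₀ p P) {m m' : PatchOn (augPrices p₀ p) 0 → ℝ} {ε : ℝ}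
    (h : ∀ i, m i ≤ m' i + ε) :
    m ⬝ᵥ (counterfactualRows p₀ p *ᵥ ν) ≤ m' ⬝ᵥ (counterfactualRows p₀ p *ᵥ ν) + ε := by
  rw [dotProduct_counterfactualRows_mulVec, dotProduct_counterfactualRows_mulVec]
  calc ∑ t, ν t * m (t.1 0) ≤ ∑ t, ν t * (m' (t.1 0) + ε) :=
        Finset.sum_le_sum fun t _ => mul_le_mul_of_nonneg_left (h _) (hν.1.1 t)
    _ = ∑ t, ν t * m' (t.1 0) + ε := by
        simp_rw [mul_add, Finset.sum_add_distrib, ← Finset.sum_mul, hν.1.2, one_mul]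

end Counterfactual

/-- The observed demand system `P` at prices `p j ∈ ℝ^K_+` is rationalizable, and `z'y` is bounded on
the (nonempty) counterfactual budget. Then both linear programs have optimal values, these bound
`𝔼 (z'y(p₀))`, and the bounds are sharp: no larger lower bound and no smaller upper bound is valid
for all counterfactual distributions that are consistent with the observed demand system. -/
theorem corollary1 {K J : ℕ} (p₀ : Fin K → ℝ) (p : Fin J → Fin K → ℝ)
    (hp₀ : 0 ≤ p₀) (hp₀_ne : p₀ ≠ 0) (hp : ∀ j, 0 ≤ p j)
    (P : Fin J → Measure (Fin K → ℝ)) (hP : Rationalizable p P)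
    (z : Fin K → ℝ) (hz : Bornology.IsBounded ((fun y => z ⬝ᵥ y) '' budget p₀)) :
    ∃ L U : ℝ,
      IsLeast ((fun ν => mLow p₀ p z ⬝ᵥ (counterfactualRows p₀ p *ᵥ ν)) '' feasible p₀ p P) L ∧
      IsGreatest ((fun ν => mHigh p₀ p z ⬝ᵥ (counterfactualRows p₀ p *ᵥ ν)) '' feasible p₀ p P) U ∧
      (∀ P₀ : Measure (Fin K → ℝ), Rationalizable (augPrices p₀ p) (augDemand P₀ P) →
        Integrable (fun y => z ⬝ᵥ y) P₀ ∧ L ≤ ∫ y, z ⬝ᵥ y ∂P₀ ∧ ∫ y, z ⬝ᵥ y ∂P₀ ≤ U) ∧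
      IsGLB (consistentMeans p₀ p P z) L ∧
      IsLUB (consistentMeans p₀ p P z) U := by
  have hcont : ∀ m : PatchOn (augPrices p₀ p) 0 → ℝ,
      Continuous fun ν => m ⬝ᵥ (counterfactualRows p₀ p *ᵥ ν) := fun m =>
    continuous_const.dotProduct (Continuous.matrix_mulVec continuous_const continuous_id)
  have hne := feasible_nonempty hp₀ hp₀_ne hp hP
  obtain ⟨L, hL⟩ := (isCompact_feasible.image (hcont (mLow p₀ p z))).exists_isLeast (hne.image _)
  obtain ⟨U, hU⟩ :=
    (isCompact_feasible.image (hcont (mHigh p₀ p z))).exists_isGreatest (hne.image _)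
  have hbound : ∀ P₀ : Measure (Fin K → ℝ), Rationalizable (augPrices p₀ p) (augDemand P₀ P) →
      Integrable (fun y => z ⬝ᵥ y) P₀ ∧ L ≤ ∫ y, z ⬝ᵥ y ∂P₀ ∧ ∫ y, z ⬝ᵥ y ∂P₀ ≤ U := by
    intro P₀ h
    obtain ⟨hi, ν, hν, hlow, hhigh⟩ := integrable_and_exists_feasible_bounds h hz
    exact ⟨hi, (hL.2 ⟨ν, hν, rfl⟩).trans hlow, hhigh.trans (hU.2 ⟨ν, hν, rfl⟩)⟩
  have himage : ∀ i : PatchOn (augPrices p₀ p) 0, ((fun y => z ⬝ᵥ y) '' i.set).Nonempty :=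
    fun i => i.2.2.image _
  refine ⟨L, U, hL, hU, hbound, ⟨?_, fun b hb => ?_⟩, ⟨?_, fun b hb => ?_⟩⟩
  · rintro _ ⟨P₀, h, rfl⟩
    exact (hbound P₀ h).2.1
  · obtain ⟨ν, hν, rfl⟩ := hL.1
    -- Patches need not be closed, so the infimum is only approached, within `ε` on every patch at
    -- once.
    refine le_of_forall_pos_le_add fun ε hε => ?_
    have hex : ∀ i : PatchOn (augPrices p₀ p) 0, ∃ y ∈ i.set, z ⬝ᵥ y ≤ mLow p₀ p z i + ε := by
      intro i
      obtain ⟨_, ⟨y, hy, rfl⟩, hlt⟩ := exists_lt_of_csInf_lt (himage i) (lt_add_of_pos_right _ hε)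
      exact ⟨y, hy, hlt.le⟩
    choose c hc hcε using hex
    obtain ⟨P₀, hP₀, hmean⟩ := exists_rationalizable_of_feasible hp₀ hp hP hν c hc
    refine (hb ⟨P₀, hP₀, rfl⟩).trans ?_
    rw [hmean]
    exact dotProduct_counterfactualRows_le hν hcε
  · rintro _ ⟨P₀, h, rfl⟩
    exact (hbound P₀ h).2.2
  · obtain ⟨ν, hν, rfl⟩ := hU.1
    refine le_of_forall_pos_le_add fun ε hε => ?_
    have hex : ∀ i : PatchOn (augPrices p₀ p) 0, ∃ y ∈ i.set, mHigh p₀ p z i ≤ z ⬝ᵥ y + ε := by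
      intro i
      obtain ⟨_, ⟨y, hy, rfl⟩, hlt⟩ := exists_lt_of_lt_csSup (himage i) (sub_lt_self _ hε)
      exact ⟨y, hy, by linarith [show mHigh p₀ p z i - ε < z ⬝ᵥ y from hlt]⟩
    choose c hc hcε using hex
    obtain ⟨P₀, hP₀, hmean⟩ := exists_rationalizable_of_feasible hp₀ hp hP hν c hc
    refine (dotProduct_counterfactualRows_le hν hcε).trans ?_
    rw [← hmean]
    exact add_le_add_left (hb ⟨P₀, hP₀, rfl⟩) _
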